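/- **The calculus $\mathbf{G4}$.** Formulas are built from propositional variables with the constant $\bot$, the binary connectives $\land,\lor,\to$ and the unary connective $\Box$. A sequent $\Gamma\Rightarrow\Delta$ is a pair of finite multisets of formulas (left and right side); equivalently, it is a finite multiset of formulas each labelled $\mathtt l$ or $\mathtt r$. For a multiset $\Gamma$, $\Box\Gamma$ denotes the multiset of all $\Box A$ with $A$ in $\Gamma$. Ono's calculus $\mathbf{G4}$ for the intuitionistic modal logic L4 has the initial sequents $x\Rightarrow x$ ($x$ a variable); the structural rules of weakening (pass from a sequent to any sequent containing it), contraction (reduce multiplicities of formulas, keeping at least one copy of each) and multicut $$\frac{\Gamma\Rightarrow\Delta,C^p\qquad \Gamma',C^q\Rightarrow\Delta'}{\Gamma,\Gamma'\Rightarrow\Delta,\Delta'}\quad(p,q\ge 1);$$ and the logical rules $$\frac{}{\Gamma,\bot\Rightarrow\Delta}\quad \frac{\Gamma\Rightarrow\Delta}{\Gamma\Rightarrow\bot,\Delta}\quad \frac{\Gamma,A,B\Rightarrow\Delta}{\Gamma,A\land B\Rightarrow\Delta}\quad \frac{\Gamma\Rightarrow A,\Delta\quad \Gamma\Rightarrow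 B,\Delta}{\Gamma\Rightarrow A\land B,\Delta}$$ $$\frac{\Gamma,A\Rightarrow\Delta\quad \Gamma,B\Rightarrow\Delta}{\Gamma,A\lor B\Rightarrow\Delta}\quad \frac{\Gamma\Rightarrow A,B,\Delta}{\Gamma\Rightarrow A\lor B,\Delta}\quad \frac{\Gamma\Rightarrow A,\Delta\quad \Gamma,B\Rightarrow\Delta}{\Gamma,A\to B\Rightarrow\Delta}\quad \frac{\Gamma,A\Rightarrow B,\Box\Delta}{\Gamma\Rightarrow A\to B,\Box\Delta}\;(\to\mathtt r)_\Box$$ $$\frac{\Gamma,A\Rightarrow\Delta}{\Gamma,\Box A\Rightarrow\Delta}\;(T)\qquad \frac{\Box\Gamma\Rightarrow A,\Box\Delta}{\Box\Gamma\Rightarrow\Box A,\Box\Delta}\;(5)$$ So each connective $\circ$ has one left rule $(\circ\mathtt l)$ and one right rule $(\circ\mathtt r)$; for $\to$ the right rule is $(\to\mathtt r)_\Box$, and for $\Box$ the two rules are $(T)$ and $(5)$. For each of these logical rules $\mathbf R$ let $\mathcal C(\mathbf R)$ be the set of labelled formulas allowed in its context: $\mathcal C((\to\mathtt r)_\Box)$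 consists of all formulas labelled $\mathtt l$ and all boxed formulas labelled $\mathtt r$, $\mathcal C((5))$ consists of all boxed formulas with either label, and $\mathcal C(\mathbf R)$ is the set of all labelled formulas (no context restriction) for every other $\mathbf R$. For a set $\mathcal C$ of labelled formulas, $\overline{\mathcal C}$ is obtained from it by swapping the labels $\mathtt l$ and $\mathtt r$. A connective $\circ$ is - *rightable* if, for every formula $C$ with outermost connective $\circ$ and every logical rule $\mathbf R$, $C^{\mathtt r}\in\mathcal C(\mathbf R)$ implies that $\mathbf R$ has no context restriction; - *weakly leftable* if, for all such $C$ and $\mathbf R$, $C^{\mathtt l}\in\mathcal C(\mathbf R)$ implies $\mathcal C(\circ\mathtt r)\subseteq\mathcal C(\mathbf R)$; - *inverse rightable* if, for all such $C$ and $\mathbf R$, $C^{\mathtt r}\in\mathcal C(\mathbf R)$ implies $\overline{\mathcal C(\circ\mathtt r)}\subseteq\mathcal C(\mathbf R)$. A multicut is *analytic* if its cut formula $C$ is a subformula (possibly improper) of some formula in the conclusion of that multicut. **Corollary.** $\mathbf{G4}$ has the analytic cut property: every sequent provable in $\mathbf{G4}$ has a proof in $\mathbf{G4}$ in which every multicut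 is analytic. Moreover, in $\mathbf{G4}$ the connective $\to$ is rightable and weakly leftable, and $\Box$ is weakly leftable and inverse rightable. -/

import Mathlib

namespace CutRestriction

universe u v

/-- A propositional language: a set of connectives, each with a finite arity. -/
structure PropLanguage where
  Con : Type u
  arity : Con → ℕ

/-- Formulas over the language `L` with propositional variables from `Var`. -/
inductive Formula (L : PropLanguage.{u}) (Var : Type v) : Type (max u v)
  | var : Var → Formula L Var
  | conn : (c : L.Con) → (Fin (L.arity c) → Formula L Var) → Formula L Var

namespace Formula

variable {L : PropLanguage.{u}} {Var : Type v}

/-- `Subformula A B`: `A` is a (not necessarily proper) subformula of `B`. -/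
inductive Subformula : Formula L Var → Formula L Var → Prop
  | refl (A : Formula L Var) : Subformula A A
  | arg {A : Formula L Var} {c : L.Con} {args : Fin (L.arity c) → Formula L Var}
      (i : Fin (L.arity c)) : Subformula A (args i) → Subformula A (conn c args)

def ProperSubformula (A B : Formula L Var) : Prop := Subformula A B ∧ A ≠ B

/-- Simultaneous substitution. -/
def bind (σ : Var → Formula L Var) : Formula L Var → Formula L Var
  | var x => σ x
  | conn c args => conn c (fun i => (args i).bind σ)

open Classical in
/-- `F.replace x A` replaces all occurrences of the variable `x` in `F` by the formula `A`. -/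
noncomputable def replace (F : Formula L Var) (x : Var) (A : Formula L Var) : Formula L Var :=
  F.bind (Function.update var x A)

theorem arg_ne (F : Formula L Var) :
    ∀ (c : L.Con) (args : Fin (L.arity c) → Formula L Var) (i : Fin (L.arity c)),
      F = conn c args → args i ≠ F := by
  induction F with
  | var x => intro c args i h; cases h
  | conn c' args' ih =>
    intro c args i h
    cases h
    intro h
    exact ih i c' args' i h rfl

theorem properSubformula_arg (c : L.Con) (args : Fin (L.arity c) → Formula L Var)
    (i : Fin (L.arity c)) : ProperSubformula (args i) (conn c args) :=
  ⟨.arg i (.refl _), arg_ne _ c args i rfl⟩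

end Formula

/-- The two labels: `l` (antecedent) and `r` (succedent). -/
inductive Side
  | l
  | r

/-- Inversion of labels. -/
def Side.inv : Side → Side
  | .l => .r
  | .r => .l

/-- Labelled formulas. -/
structure LFormula (L : PropLanguage.{u}) (Var : Type v) : Type (max u v) where
  side : Side
  formula : Formula L Var

namespace LFormula

variable {L : PropLanguage.{u}} {Var : Type v}

def inv (F : LFormula L Var) : LFormula L Var := ⟨F.side.inv, F.formula⟩

noncomputable def replace (F : LFormula L Var) (x : Var) (A : Formula L Var) : LFormula L Var :=
  ⟨F.side, F.formula.replace x A⟩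

end LFormula

/-- Sequents are finite multisets of labelled formulas. -/
abbrev Sequent (L : PropLanguage.{u}) (Var : Type v) := Multiset (LFormula L Var)

/-- `IsContraction Γ' Γ`: the sequent `Γ'` is a contraction of `Γ`. -/
def IsContraction {L : PropLanguage.{u}} {Var : Type v} (Γ' Γ : Sequent L Var) : Prop :=
  (∀ F, F ∈ Γ' ↔ F ∈ Γ) ∧ Γ' ≤ Γ

/-- Simple rules introducing the connective `c` on side `s`. An element `(args, Λ)` of `insts`
stands for the tuple `(C, Λ 0, …, Λ (M - 1))` with principal formula `C = conn c args`,
labelled by `s`; `ctx` is the context restriction. -/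
structure SimpleRule (L : PropLanguage.{u}) (Var : Type v) (s : Side) (c : L.Con) where
  M : ℕ
  insts : Set ((Fin (L.arity c) → Formula L Var) × (Fin M → Sequent L Var))
  ctx : Set (LFormula L Var)
  auxiliary : ∀ args Λ, (args, Λ) ∈ insts → ∀ m, ∀ F ∈ Λ m,
    F.formula.ProperSubformula (.conn c args)
  insts_subst : ∀ args Λ, (args, Λ) ∈ insts → ∀ (x : Var) (A : Formula L Var),
    ((fun i => (args i).replace x A), (fun m => (Λ m).map (fun F => F.replace x A))) ∈ insts
  ctx_subst : ∀ F ∈ ctx, ∀ (x : Var) (A : Formula L Var), F.replace x A ∈ ctx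
  total : ∀ args, ∃ Λ, (args, Λ) ∈ insts

/-- A standard calculus: a simple left rule and a simple right rule for every connective.
The initial sequents and the structural rules are the same for all standard calculi, see
`Deduction`. -/
structure StandardCalculus (L : PropLanguage.{u}) (Var : Type v) where
  rule : (s : Side) → (c : L.Con) → SimpleRule L Var s c

namespace StandardCalculus

variable {L : PropLanguage.{u}} {Var : Type v}

/-- Deductions of a sequent from a set `Ω` of sequents. -/
inductive Deduction (S : StandardCalculus L Var) (Ω : Set (Sequent L Var)) :
    Sequent L Var → Type (max u v)
  | hyp (Γ : Sequent L Var) (h : Γ ∈ Ω) : Deduction S Ω Γ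
  | id (x : Var) : Deduction S Ω {⟨.l, .var x⟩, ⟨.r, .var x⟩}
  | w (Γ Δ : Sequent L Var) (d : Deduction S Ω Γ) : Deduction S Ω (Γ + Δ)
  | c (Γ Γ' : Sequent L Var) (h : IsContraction Γ' Γ) (d : Deduction S Ω Γ) : Deduction S Ω Γ'
  | mcut (Γ Δ : Sequent L Var) (C : Formula L Var) (p q : ℕ) (hp : p ≠ 0) (hq : q ≠ 0)
      (d₁ : Deduction S Ω (Γ + Multiset.replicate p ⟨.r, C⟩))
      (d₂ : Deduction S Ω (Δ + Multiset.replicate q ⟨.l, C⟩)) : Deduction S Ω (Γ + Δ)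
  | simple (s : Side) (k : L.Con) (args : Fin (L.arity k) → Formula L Var)
      (Λ : Fin (S.rule s k).M → Sequent L Var) (h : (args, Λ) ∈ (S.rule s k).insts)
      (Γ : Sequent L Var) (hΓ : ∀ F ∈ Γ, F ∈ (S.rule s k).ctx)
      (d : ∀ m, Deduction S Ω (Γ + Λ m)) : Deduction S Ω (Γ + {⟨s, .conn k args⟩})

/-- All instances of multicut are analytic: the cut formula is a subformula of some formula
in the conclusion of that instance. -/
def Deduction.LocallyAnalytic {S : StandardCalculus L Var} {Ω : Set (Sequent L Var)} :
    {Γ : Sequent L Var} → S.Deduction Ω Γ → Prop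
  | _, .hyp _ _ => True
  | _, .id _ => True
  | _, .w _ _ d => d.LocallyAnalytic
  | _, .c _ _ _ d => d.LocallyAnalytic
  | _, .mcut Γ Δ C _ _ _ _ d₁ d₂ =>
      (∃ F ∈ Γ + Δ, C.Subformula F.formula) ∧ d₁.LocallyAnalytic ∧ d₂.LocallyAnalytic
  | _, .simple _ _ _ _ _ _ _ d => ∀ m, (d m).LocallyAnalytic

/-- Proofs are deductions from no hypotheses. -/
abbrev Proof (S : StandardCalculus L Var) (Γ : Sequent L Var) := S.Deduction ∅ Γ

def Provable (S : StandardCalculus L Var) (Γ : Sequent L Var) : Prop := Nonempty (S.Proof Γ)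

def AnalyticCutProperty (S : StandardCalculus L Var) : Prop :=
  ∀ Γ : Sequent L Var, S.Provable Γ → ∃ d : S.Proof Γ, d.LocallyAnalytic

def Rightable (S : StandardCalculus L Var) (c : L.Con) : Prop :=
  ∀ (args : Fin (L.arity c) → Formula L Var) (s : Side) (k : L.Con),
    ⟨.r, .conn c args⟩ ∈ (S.rule s k).ctx → (S.rule s k).ctx = Set.univ

def WeaklyLeftable (S : StandardCalculus L Var) (c : L.Con) : Prop :=
  ∀ (args : Fin (L.arity c) → Formula L Var) (s : Side) (k : L.Con),
    ⟨.l, .conn c args⟩ ∈ (S.rule s k).ctx → (S.rule .r c).ctx ⊆ (S.rule s k).ctx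

def InverseRightable (S : StandardCalculus L Var) (c : L.Con) : Prop :=
  ∀ (args : Fin (L.arity c) → Formula L Var) (s : Side) (k : L.Con),
    ⟨.r, .conn c args⟩ ∈ (S.rule s k).ctx →
      LFormula.inv '' (S.rule .r c).ctx ⊆ (S.rule s k).ctx

end StandardCalculus

/-- The simple rule given by a schema: `prem m` lists the auxiliary formulas of the `m`-th
premise, where `(t, i)` stands for the `i`-th argument of the principal formula, labelled `t`. -/
def SimpleRule.schematic {L : PropLanguage.{u}} {Var : Type v} (s : Side) (c : L.Con) {M : ℕ}
    (prem : Fin M → Multiset (Side × Fin (L.arity c))) (ctx : Set (LFormula L Var))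
    (hctx : ∀ F ∈ ctx, ∀ (x : Var) (A : Formula L Var), F.replace x A ∈ ctx) :
    SimpleRule L Var s c where
  M := M
  insts := {a | a.2 = fun m => (prem m).map (fun t => ⟨t.1, a.1 t.2⟩)}
  ctx := ctx
  auxiliary := by
    intro args Λ h m F hF
    simp only [Set.mem_ofPred_eq] at h
    subst h
    obtain ⟨t, -, rfl⟩ := Multiset.mem_map.1 hF
    exact Formula.properSubformula_arg c args t.2
  insts_subst := by
    intro args Λ h x A
    simp only [Set.mem_ofPred_eq] at h
    subst h
    simp only [Set.mem_ofPred_eq, Multiset.map_map]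
    rfl
  ctx_subst := hctx
  total := fun args => ⟨fun m => (prem m).map (fun t => ⟨t.1, args t.2⟩), by simp⟩

/-- The connectives of the language of intuitionistic modal logic. -/
inductive ModalCon
  | bot
  | and
  | or
  | imp
  | box

/-- The language with connectives `⊥`, `∧`, `∨`, `→`, `□`. -/
def modalLanguage : PropLanguage.{0} where
  Con := ModalCon
  arity
    | .bot => 0
    | .and => 2
    | .or => 2
    | .imp => 2
    | .box => 1

namespace G4

variable {Var : Type v}

/-- The formula `□ A`. -/
def box (A : Formula modalLanguage Var) : Formula modalLanguage Var :=
  .conn (L := modalLanguage) ModalCon.box (fun _ => A)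

/-- Context restriction of the rule `(5)`: boxed formulas on both sides. -/
def ctxFive (Var : Type v) : Set (LFormula modalLanguage Var) :=
  {F | ∃ A, F.formula = box A}

/-- Context restriction of the right rule for `→`: arbitrary formulas on the left, boxed
formulas on the right. -/
def ctxImp (Var : Type v) : Set (LFormula modalLanguage Var) :=
  {F | F.side = .l ∨ (F.side = .r ∧ ∃ A, F.formula = box A)}

theorem ctxFive_subst : ∀ F ∈ ctxFive Var, ∀ (x : Var) (A : Formula modalLanguage Var),
    F.replace x A ∈ ctxFive Var := by
  rintro ⟨s, F⟩ ⟨B, hB⟩ x A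
  simp only at hB
  subst hB
  exact ⟨B.replace x A, rfl⟩

theorem ctxImp_subst : ∀ F ∈ ctxImp Var, ∀ (x : Var) (A : Formula modalLanguage Var),
    F.replace x A ∈ ctxImp Var := by
  rintro ⟨s, F⟩ (h | ⟨h, B, hB⟩) x A
  · exact Or.inl h
  · simp only at hB
    subst hB
    exact Or.inr ⟨h, B.replace x A, rfl⟩

/-- A schematic rule without context restriction. -/
def free (s : Side) (c : ModalCon) {M : ℕ}
    (prem : Fin M → Multiset (Side × Fin (modalLanguage.arity c))) :
    SimpleRule modalLanguage Var s c :=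
  .schematic (L := modalLanguage) s c prem Set.univ (fun _ _ _ _ => Set.mem_univ _)

/-- The logical rules of `G4`. -/
def rules (Var : Type v) : (s : Side) → (c : ModalCon) → SimpleRule modalLanguage Var s c
  | .l, .bot => free .l .bot ![]
  | .r, .bot => free .r .bot ![0]
  | .l, .and => free .l .and ![{(.l, (0 : Fin 2)), (.l, (1 : Fin 2))}]
  | .r, .and => free .r .and ![{(.r, (0 : Fin 2))}, {(.r, (1 : Fin 2))}]
  | .l, .or => free .l .or ![{(.l, (0 : Fin 2))}, {(.l, (1 : Fin 2))}]
  | .r, .or => free .r .or ![{(.r, (0 : Fin 2)), (.r, (1 : Fin 2))}]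
  | .l, .imp => free .l .imp ![{(.r, (0 : Fin 2))}, {(.l, (1 : Fin 2))}]
  | .r, .imp => .schematic (L := modalLanguage) .r ModalCon.imp ![{(.l, (0 : Fin 2)), (.r, (1 : Fin 2))}]
      (ctxImp Var) ctxImp_subst
  | .l, .box => free .l .box ![{(.l, (0 : Fin 1))}]
  | .r, .box => .schematic (L := modalLanguage) .r ModalCon.box ![{(.r, (0 : Fin 1))}] (ctxFive Var) ctxFive_subst

end G4

/-- The calculus `G4` over the propositional variables `Var`. -/
def G4 (Var : Type v) : StandardCalculus modalLanguage Var where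
  rule := G4.rules Var

end CutRestriction

namespace CutRestriction

/-! The argument is semantic rather than by cut elimination. Call a sequent analytically provable if
it has a proof with only analytic multicuts. If a sequent is not analytically provable, cuts on its
subformulas let it be extended to a saturated one: still analytically unprovable, and with every
subformula placed on the left or on the right (`exists_saturated`). The only cuts this needs are on
subformulas of formulas already present, so they are analytic.

Fix such a saturated `Γ₀`. The saturated sequents with exactly the same labelled boxed formulas as
`Γ₀`, ordered by inclusion of left parts, form an intuitionistic Kripke model in which `□`
quantifies over all worlds. The context restrictions of `(→r)` and `(5)` keep all boxed formulas, so
the unprovable premises of these rules extend to worlds of the same model. This gives the truth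
lemma `World.truth`: left formulas are forced, right formulas are not. Thus `Γ₀` is refuted at
itself. But G4 with arbitrary multicuts is sound for these models (`soundness`), so the original
sequent was not provable at all.

The statements on contexts are a check of the ten rules. -/

theorem mem_pair_left {α : Type*} (a b : α) : a ∈ ({a, b} : Multiset α) := by simp

theorem mem_pair_right {α : Type*} (a b : α) : b ∈ ({a, b} : Multiset α) := by simp

/-! ### Subformulas -/

namespace Formula

variable {L : PropLanguage.{u}} {Var : Type v}

theorem Subformula.trans {A B C : Formula L Var} (h₁ : A.Subformula B) (h₂ : B.Subformula C) :
    A.Subformula C := by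
  induction h₂ with
  | refl => exact h₁
  | arg i _ ih => exact .arg i ih

theorem finite_subformulas [∀ c, Finite (Fin (L.arity c))] (B : Formula L Var) :
    {A : Formula L Var | A.Subformula B}.Finite := by
  induction B with
  | var x =>
    refine (Set.finite_singleton (var x)).subset ?_
    rintro A h
    cases h
    rfl
  | conn c args ih =>
    refine ((Set.finite_singleton (conn c args)).union (Set.finite_iUnion ih)).subset ?_
    rintro A h
    cases h with
    | refl => exact Or.inl rfl
    | arg i h => exact Or.inr (Set.mem_iUnion.2 ⟨i, h⟩)

end Formula

/-! ### Analytic provability -/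

namespace StandardCalculus

variable {L : PropLanguage.{u}} {Var : Type v} {S : StandardCalculus L Var}

/-- Provability by a proof all of whose multicuts are analytic. -/
def AnalyticProvable (S : StandardCalculus L Var) (Γ : Sequent L Var) : Prop :=
  ∃ d : S.Proof Γ, d.LocallyAnalytic

/-- Weakening followed by contraction makes multiplicities irrelevant, so sequents can be treated as
sets from here on. -/
theorem AnalyticProvable.mono {Γ Δ : Sequent L Var} (h : S.AnalyticProvable Γ) (hs : Γ ⊆ Δ) :
    S.AnalyticProvable Δ := by
  obtain ⟨d, hd⟩ := h
  have hc : IsContraction Δ (Γ + Δ) := by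
    refine ⟨fun F => ?_, Multiset.le_add_left _ _⟩
    rw [Multiset.mem_add]
    exact ⟨Or.inr, fun h => h.elim (fun h => hs h) _root_.id⟩
  refine ⟨.c (Γ + Δ) Δ hc (.w Γ Δ d), ?_⟩
  simpa only [Deduction.LocallyAnalytic] using hd

theorem AnalyticProvable.initial (x : Var) :
    S.AnalyticProvable {⟨.l, .var x⟩, ⟨.r, .var x⟩} :=
  ⟨.id x, by simp only [Deduction.LocallyAnalytic]⟩

theorem AnalyticProvable.cut {Γ : Sequent L Var} {C : Formula L Var}
    (hC : ∃ F ∈ Γ, C.Subformula F.formula)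
    (h₁ : S.AnalyticProvable (Γ + {⟨.r, C⟩})) (h₂ : S.AnalyticProvable (Γ + {⟨.l, C⟩})) :
    S.AnalyticProvable Γ := by
  obtain ⟨d₁, hd₁⟩ := h₁
  obtain ⟨d₂, hd₂⟩ := h₂
  have h : S.AnalyticProvable (Γ + Γ) := by
    refine ⟨.mcut Γ Γ C 1 1 one_ne_zero one_ne_zero d₁ d₂, ?_⟩
    simp only [Deduction.LocallyAnalytic]
    refine ⟨?_, hd₁, hd₂⟩
    obtain ⟨F, hF, hs⟩ := hC
    exact ⟨F, Multiset.mem_add.2 (Or.inl hF), hs⟩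
  exact h.mono fun F hF => (Multiset.mem_add.1 hF).elim id id

theorem AnalyticProvable.schematic {s : Side} {k : L.Con} {M : ℕ}
    {prem : Fin M → Multiset (Side × Fin (L.arity k))} {ctx : Set (LFormula L Var)}
    {hctx : ∀ F ∈ ctx, ∀ (x : Var) (A : Formula L Var), F.replace x A ∈ ctx}
    (hR : S.rule s k = .schematic s k prem ctx hctx) (args : Fin (L.arity k) → Formula L Var)
    {Γ : Sequent L Var} (hΓ : ∀ F ∈ Γ, F ∈ ctx)
    (d : ∀ m, S.AnalyticProvable (Γ + (prem m).map fun t => ⟨t.1, args t.2⟩)) :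
    S.AnalyticProvable (Γ + {⟨s, .conn k args⟩}) := by
  choose d hd using d
  -- The number of premises depends on the rule, so the rule is generalised to a variable `R` before
  -- the equation is eliminated.
  have key : ∀ {R : SimpleRule L Var s k} (_ : S.rule s k = R) (Λ : Fin R.M → Sequent L Var)
      (_ : (args, Λ) ∈ R.insts) (_ : ∀ F ∈ Γ, F ∈ R.ctx) (d : ∀ m, S.Proof (Γ + Λ m))
      (_ : ∀ m, (d m).LocallyAnalytic), S.AnalyticProvable (Γ + {⟨s, .conn k args⟩}) := by
    rintro R rfl Λ h hΓ d hd
    refine ⟨.simple s k args Λ h Γ hΓ d, ?_⟩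
    simpa only [Deduction.LocallyAnalytic] using hd
  exact key hR (fun m => (prem m).map fun t : Side × Fin (L.arity k) => ⟨t.1, args t.2⟩) rfl hΓ d hd

theorem AnalyticProvable.schematic_of_mem {s : Side} {k : L.Con} {M : ℕ}
    {prem : Fin M → Multiset (Side × Fin (L.arity k))}
    {hctx : ∀ F ∈ (Set.univ : Set (LFormula L Var)), ∀ (x : Var) (A : Formula L Var),
      F.replace x A ∈ Set.univ}
    (hR : S.rule s k = .schematic s k prem Set.univ hctx)
    {args : Fin (L.arity k) → Formula L Var}
    {Γ : Sequent L Var} (hmem : ⟨s, .conn k args⟩ ∈ Γ)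
    (d : ∀ m, S.AnalyticProvable (Γ + (prem m).map fun t => ⟨t.1, args t.2⟩)) :
    S.AnalyticProvable Γ := by
  refine (AnalyticProvable.schematic hR args (fun F _ => Set.mem_univ F) d).mono fun F hF => ?_
  rcases Multiset.mem_add.1 hF with hF | hF
  · exact hF
  · rwa [Multiset.mem_singleton.1 hF]

/-! ### Saturated sequents -/

/-- An analytically unprovable sequent in which every subformula occurs on one of the sides. -/
structure Saturated (S : StandardCalculus L Var) (Γ : Sequent L Var) : Prop where
  unprovable : ¬ S.AnalyticProvable Γ
  decided : ∀ F ∈ Γ, ∀ C : Formula L Var, C.Subformula F.formula → ⟨.l, C⟩ ∈ Γ ∨ ⟨.r, C⟩ ∈ Γ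

/-- The formulas of `T` are added one at a time. If neither label for `C` could be added while
staying unprovable, a cut on `C` would prove the sequent; this cut is analytic because `C` is a
subformula of a formula of `Γ`, hence of the current sequent. -/
theorem exists_decided {Γ : Sequent L Var} (h : ¬ S.AnalyticProvable Γ)
    {T : Set (Formula L Var)} (hT : T.Finite)
    (hsub : ∀ C ∈ T, ∃ F ∈ Γ, C.Subformula F.formula) :
    ∃ Δ : Sequent L Var, Γ ⊆ Δ ∧ ¬ S.AnalyticProvable Δ ∧
      (∀ C ∈ T, ⟨.l, C⟩ ∈ Δ ∨ ⟨.r, C⟩ ∈ Δ) ∧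
      ∀ F ∈ Δ, ∃ G ∈ Γ, F.formula.Subformula G.formula := by
  induction T, hT using Set.Finite.induction_on with
  | empty => exact ⟨Γ, fun _ h => h, h, by simp, fun F hF => ⟨F, hF, .refl _⟩⟩
  | @insert C T _ _ ih =>
    obtain ⟨Δ, hΓ, hΔ, hdec, hF⟩ := ih fun D hD => hsub D (Or.inr hD)
    obtain ⟨G, hG, hCG⟩ := hsub C (Or.inl rfl)
    have key : ∃ s : Side, ¬ S.AnalyticProvable (Δ + {⟨s, C⟩}) := by
      by_contra! hcon
      exact hΔ (AnalyticProvable.cut ⟨G, hΓ hG, hCG⟩ (hcon .r) (hcon .l))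
    obtain ⟨s, hs⟩ := key
    refine ⟨Δ + {⟨s, C⟩}, fun F hF => Multiset.mem_add.2 (Or.inl (hΓ hF)), hs, ?_, ?_⟩
    · rintro D (rfl | hD)
      · cases s <;> simp
      · exact (hdec D hD).imp (fun h => Multiset.mem_add.2 (Or.inl h))
          fun h => Multiset.mem_add.2 (Or.inl h)
    · intro F h
      rcases Multiset.mem_add.1 h with h | h
      · exact hF F h
      · rw [Multiset.mem_singleton.1 h]
        exact ⟨G, hG, hCG⟩

theorem exists_saturated {Γ : Sequent L Var} (h : ¬ S.AnalyticProvable Γ) :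
    ∃ Δ : Sequent L Var, Γ ⊆ Δ ∧ S.Saturated Δ ∧
      ∀ F ∈ Δ, ∃ G ∈ Γ, F.formula.Subformula G.formula := by
  have hfin : {C : Formula L Var | ∃ F ∈ Γ, C.Subformula F.formula}.Finite := by
    classical
    have : {C : Formula L Var | ∃ F ∈ Γ, C.Subformula F.formula} =
        ⋃ F ∈ Γ.toFinset, {C : Formula L Var | C.Subformula F.formula} := by
      ext C
      simp
    rw [this]
    exact Set.Finite.biUnion (Finset.finite_toSet _) fun F _ => F.formula.finite_subformulas
  obtain ⟨Δ, hΓ, hΔ, hdec, hF⟩ := exists_decided h hfin fun C hC => hC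
  refine ⟨Δ, hΓ, ⟨hΔ, fun F h C hC => ?_⟩, hF⟩
  obtain ⟨G, hG, hFG⟩ := hF F h
  exact hdec C ⟨G, hG, hC.trans hFG⟩

theorem Saturated.not_mem_right {Γ : Sequent L Var} (h : S.Saturated Γ)
    (hid : ∀ A : Formula L Var, S.AnalyticProvable {⟨.l, A⟩, ⟨.r, A⟩}) {A : Formula L Var}
    (hl : ⟨.l, A⟩ ∈ Γ) : ⟨.r, A⟩ ∉ Γ := by
  refine fun hr => h.unprovable ((hid A).mono ?_)
  simp [Multiset.subset_iff, hl, hr]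

open Classical in
-- Contrapositive of the rule, applied with the largest context the restriction admits: the part of
-- `Γ` lying in `ctx`.
theorem exists_unprovable_premise {s : Side} {k : L.Con} {M : ℕ}
    {prem : Fin M → Multiset (Side × Fin (L.arity k))} {ctx : Set (LFormula L Var)}
    {hctx : ∀ F ∈ ctx, ∀ (x : Var) (A : Formula L Var), F.replace x A ∈ ctx}
    (hR : S.rule s k = .schematic s k prem ctx hctx) {args : Fin (L.arity k) → Formula L Var}
    {Γ : Sequent L Var} (hΓ : ¬ S.AnalyticProvable Γ) (hmem : ⟨s, .conn k args⟩ ∈ Γ) :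
    ∃ m, ¬ S.AnalyticProvable
      (Γ.filter (· ∈ ctx) + (prem m).map fun t => ⟨t.1, args t.2⟩) := by
  by_contra! hcon
  refine hΓ ((AnalyticProvable.schematic hR args
    (fun F hF => (Multiset.mem_filter.1 hF).2) hcon).mono fun F hF => ?_)
  rcases Multiset.mem_add.1 hF with hF | hF
  · exact (Multiset.mem_filter.1 hF).1
  · rwa [Multiset.mem_singleton.1 hF]

/-- A saturated sequent is closed under inverses of the rules without context restriction. -/
theorem Saturated.exists_premise_mem {s : Side} {k : L.Con} {M : ℕ}
    {prem : Fin M → Multiset (Side × Fin (L.arity k))}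
    {hctx : ∀ F ∈ (Set.univ : Set (LFormula L Var)), ∀ (x : Var) (A : Formula L Var),
      F.replace x A ∈ Set.univ}
    (hR : S.rule s k = .schematic s k prem Set.univ hctx)
    (hid : ∀ A : Formula L Var, S.AnalyticProvable {⟨.l, A⟩, ⟨.r, A⟩})
    {args : Fin (L.arity k) → Formula L Var}
    {Γ : Sequent L Var} (hΓ : S.Saturated Γ) (hmem : ⟨s, .conn k args⟩ ∈ Γ) :
    ∃ m, ∀ t ∈ prem m, ⟨t.1, args t.2⟩ ∈ Γ := by
  by_contra! hcon
  refine hΓ.unprovable (AnalyticProvable.schematic_of_mem hR hmem fun m => ?_)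
  -- An auxiliary formula missing from `Γ` must occur there with the opposite label, so the premise
  -- contains an identity sequent.
  obtain ⟨⟨t, i⟩, ht, hn⟩ := hcon m
  refine (hid (args i)).mono ?_
  have hm : (⟨t, args i⟩ : LFormula L Var) ∈ (prem m).map fun t => ⟨t.1, args t.2⟩ :=
    Multiset.mem_map.2 ⟨(t, i), ht, rfl⟩
  have hd := hΓ.decided _ hmem (args i) (.arg i (.refl _))
  intro F hF
  rw [Multiset.mem_add]
  cases t <;> rcases hd with hd | hd <;> first | exact absurd hd hn | skip
  all_goals
    simp only [Multiset.insert_eq_cons, Multiset.mem_cons, Multiset.mem_singleton] at hF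
    rcases hF with rfl | rfl
    exacts [by tauto, by tauto]

end StandardCalculus

namespace G4

open StandardCalculus

variable {Var : Type v}

/-! ### Kripke semantics and soundness -/

section Kripke

variable {W : Type*} [Preorder W]

/-- The clauses for the connectives in a Kripke model of L4: those of intuitionistic logic, and
`□` as the universal modality. -/
def connForces : (c : ModalCon) → (Fin (modalLanguage.arity c) → W → Prop) → W → Prop
  | .bot, _, _ => False
  | .and, f, w => f (0 : Fin 2) w ∧ f (1 : Fin 2) w
  | .or, f, w => f (0 : Fin 2) w ∨ f (1 : Fin 2) w
  | .imp, f, w => ∀ w', w ≤ w' → f (0 : Fin 2) w' → f (1 : Fin 2) w'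
  | .box, f, _ => ∀ w', f (0 : Fin 1) w'

/-- Forcing in the Kripke model on `W` with valuation `V`. -/
def Forces (V : Var → W → Prop) : Formula modalLanguage Var → W → Prop
  | .var x => V x
  | .conn c args => connForces c fun i => Forces V (args i)

/-- A left formula holds when it is forced, a right formula when it is not. -/
def Holds (V : Var → W → Prop) (w : W) : LFormula modalLanguage Var → Prop
  | ⟨.l, A⟩ => Forces V A w
  | ⟨.r, A⟩ => ¬ Forces V A w

theorem Forces.mono {V : Var → W → Prop} (hV : ∀ x w w', w ≤ w' → V x w → V x w')
    (A : Formula modalLanguage Var) {w w' : W} (hw : w ≤ w') (h : Forces V A w) :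
    Forces V A w' := by
  induction A with
  | var x => exact hV x w w' hw h
  | conn c args ih =>
    cases c with
    | bot => exact h
    | and => exact ⟨ih _ h.1, ih _ h.2⟩
    | or => exact Or.imp (ih _) (ih _) h
    | imp => exact fun w'' hw' => h w'' (hw.trans hw')
    | box => exact h

theorem holds_singleton {V : Var → W → Prop} {w : W} {F : LFormula modalLanguage Var}
    (hF : Holds V w F) : ∀ G ∈ ({F} : Sequent modalLanguage Var), Holds V w G := by
  simpa using hF

theorem holds_pair {V : Var → W → Prop} {w : W} {F₁ F₂ : LFormula modalLanguage Var}
    (h₁ : Holds V w F₁) (h₂ : Holds V w F₂) :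
    ∀ G ∈ ({F₁, F₂} : Sequent modalLanguage Var), Holds V w G := by
  simpa using ⟨h₁, h₂⟩

/-- No world satisfies all left formulas and refutes all right ones. A multicut is handled by asking
whether the cut formula is forced, with no need for analyticity. -/
theorem soundness {V : Var → W → Prop} (hV : ∀ x w w', w ≤ w' → V x w → V x w')
    {Γ : Sequent modalLanguage Var} (d : (G4 Var).Proof Γ) (w : W) :
    ¬ ∀ F ∈ Γ, Holds V w F := by
  induction d generalizing w with
  | hyp Γ h => exact absurd h (Set.notMem_empty _)
  | id x =>
    intro h
    exact h ⟨.r, .var x⟩ (by simp) (h ⟨.l, .var x⟩ (by simp))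
  | w Γ Δ d ih => exact fun h => ih w fun F hF => h F (Multiset.mem_add.2 (Or.inl hF))
  | c Γ Γ' hc d ih => exact fun h => ih w fun F hF => h F ((hc.1 F).2 hF)
  | mcut Γ Δ C p q hp hq d₁ d₂ ih₁ ih₂ =>
    intro h
    by_cases hC : Forces V C w
    · refine ih₂ w fun F hF => ?_
      rcases Multiset.mem_add.1 hF with hF | hF
      · exact h F (Multiset.mem_add.2 (Or.inr hF))
      · rw [Multiset.eq_of_mem_replicate hF]
        exact hC
    · refine ih₁ w fun F hF => ?_
      rcases Multiset.mem_add.1 hF with hF | hF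
      · exact h F (Multiset.mem_add.2 (Or.inl hF))
      · rw [Multiset.eq_of_mem_replicate hF]
        exact hC
  | simple s k args Λ h Γ hΓ d ih =>
    intro hF
    have hp := hF _ (Multiset.mem_add.2 (Or.inr (Multiset.mem_singleton_self _)))
    have hctx : ∀ F ∈ Γ, Holds V w F := fun F h => hF F (Multiset.mem_add.2 (Or.inl h))
    have hprem : ∀ (w' : W) (m), (∀ F ∈ Γ, Holds V w' F) → ¬ ∀ F ∈ Λ m, Holds V w' F :=
      fun w' m h₁ h₂ => ih m w' fun F hF => (Multiset.mem_add.1 hF).elim (h₁ F) (h₂ F)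
    clear ih d hF
    -- The premises of a schematic rule are a function of `args`, so `h` is an equation determining
    -- `Λ`.
    cases s <;> cases k <;> (replace h : Λ = _ := h; dsimp only at h; subst h)
    · exact hp
    · exact hprem w (0 : Fin 1) hctx
        (holds_pair (F₁ := ⟨.l, args (0 : Fin 2)⟩) (F₂ := ⟨.l, args (1 : Fin 2)⟩) hp.1 hp.2)
    · rcases hp with hp | hp
      · exact hprem w (0 : Fin 2) hctx (holds_singleton (F := ⟨.l, args (0 : Fin 2)⟩) hp)
      · exact hprem w (1 : Fin 2) hctx (holds_singleton (F := ⟨.l, args (1 : Fin 2)⟩) hp)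
    · by_cases hA : Forces V (args (0 : Fin 2)) w
      · exact hprem w (1 : Fin 2) hctx (holds_singleton (F := ⟨.l, args (1 : Fin 2)⟩)
        (hp w le_rfl hA))
      · exact hprem w (0 : Fin 2) hctx (holds_singleton (F := ⟨.r, args (0 : Fin 2)⟩) hA)
    · exact hprem w (0 : Fin 1) hctx (holds_singleton (F := ⟨.l, args (0 : Fin 1)⟩)
        (hp w))
    · exact hprem w (0 : Fin 1) hctx (by simp)
    · refine hp ⟨?_, ?_⟩ <;> by_contra hA
      · exact hprem w (0 : Fin 2) hctx (holds_singleton (F := ⟨.r, args (0 : Fin 2)⟩) hA)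
      · exact hprem w (1 : Fin 2) hctx (holds_singleton (F := ⟨.r, args (1 : Fin 2)⟩) hA)
    · exact hprem w (0 : Fin 1) hctx
        (holds_pair (F₁ := ⟨.r, args (0 : Fin 2)⟩) (F₂ := ⟨.r, args (1 : Fin 2)⟩)
          (fun h => hp (Or.inl h)) fun h => hp (Or.inr h))
    · refine hp fun w' hw hA => ?_
      by_contra hB
      refine hprem w' (0 : Fin 1) ?_
        (holds_pair (F₁ := ⟨.l, args (0 : Fin 2)⟩) (F₂ := ⟨.r, args (1 : Fin 2)⟩) hA hB)
      rintro ⟨s, C⟩ hF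
      -- Passing from `w` to `w'`, left formulas persist by monotonicity, and right ones are boxed,
      -- so their truth does not depend on the world.
      rcases hΓ _ hF with rfl | ⟨rfl, D, rfl⟩
      · exact Forces.mono hV C hw (hctx _ hF)
      · exact hctx _ hF
    · refine hp fun w' => ?_
      by_contra hA
      refine hprem w' (0 : Fin 1) ?_ (holds_singleton (F := ⟨.r, args (0 : Fin 1)⟩) hA)
      rintro ⟨s, C⟩ hF
      obtain ⟨D, rfl⟩ := hΓ _ hF
      have := hctx _ hF
      cases s <;> exact this

end Kripke

/-- Initial sequents are only given for variables. For `→` and `□` the restricted right rule comes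
last in the proof; the context it needs, the same formula on the left, is admissible. -/
theorem analyticProvable_identity (A : Formula modalLanguage Var) :
    (G4 Var).AnalyticProvable {⟨.l, A⟩, ⟨.r, A⟩} := by
  induction A with
  | var x => exact .initial x
  | conn c args ih =>
    cases c with
    | bot =>
      exact .schematic_of_mem (S := G4 Var) (s := .l) (k := ModalCon.bot) rfl (args := args)
        (mem_pair_left _ _) (Fin.elim0 ·)
    | and =>
      refine .schematic_of_mem (S := G4 Var) (s := .r) (k := ModalCon.and) rfl
        (args := args) (by simp) fun m =>
        .schematic_of_mem (S := G4 Var) (s := .l) (k := ModalCon.and) rfl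
          (args := args) (by simp) fun n =>
        (ih m).mono ?_
      change Fin 2 at m
      change Fin 1 at n
      fin_cases n
      fin_cases m
      · change _ ⊆ (_ + {⟨.r, args (0 : Fin 2)⟩} + {⟨.l, args (0 : Fin 2)⟩, ⟨.l, args (1 : Fin 2)⟩} :
          Sequent modalLanguage Var)
        simp [Multiset.subset_iff]
      · change _ ⊆ (_ + {⟨.r, args (1 : Fin 2)⟩} + {⟨.l, args (0 : Fin 2)⟩, ⟨.l, args (1 : Fin 2)⟩} :
          Sequent modalLanguage Var)
        simp [Multiset.subset_iff]
    | or =>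
      refine .schematic_of_mem (S := G4 Var) (s := .l) (k := ModalCon.or) rfl
        (args := args) (by simp) fun m =>
        .schematic_of_mem (S := G4 Var) (s := .r) (k := ModalCon.or) rfl
          (args := args) (by simp) fun n =>
        (ih m).mono ?_
      change Fin 2 at m
      change Fin 1 at n
      fin_cases n
      fin_cases m
      · change _ ⊆ (_ + {⟨.l, args (0 : Fin 2)⟩} + {⟨.r, args (0 : Fin 2)⟩, ⟨.r, args (1 : Fin 2)⟩} :
          Sequent modalLanguage Var)
        simp [Multiset.subset_iff]
      · change _ ⊆ (_ + {⟨.l, args (1 : Fin 2)⟩} + {⟨.r, args (0 : Fin 2)⟩, ⟨.r, args (1 : Fin 2)⟩} :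
          Sequent modalLanguage Var)
        simp [Multiset.subset_iff]
    | imp =>
      refine .schematic (S := G4 Var) (s := .r) (k := ModalCon.imp) rfl args
        (Γ := {⟨.l, .conn _ args⟩})
        (fun F hF => ?_) fun n =>
        .schematic_of_mem (S := G4 Var) (s := .l) (k := ModalCon.imp) rfl
          (args := args) (by simp) fun m =>
        (ih m).mono ?_
      · rw [Multiset.mem_singleton.1 hF]
        exact Or.inl rfl
      · change Fin 2 at m
        change Fin 1 at n
        fin_cases n
        fin_cases m
        · change _ ⊆ (_ + {⟨.l, args (0 : Fin 2)⟩, ⟨.r, args (1 : Fin 2)⟩} + {⟨.r, args (0 : Fin 2)⟩} :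
            Sequent modalLanguage Var)
          simp [Multiset.subset_iff]
        · change _ ⊆ (_ + {⟨.l, args (0 : Fin 2)⟩, ⟨.r, args (1 : Fin 2)⟩} + {⟨.l, args (1 : Fin 2)⟩} :
            Sequent modalLanguage Var)
          simp [Multiset.subset_iff]
    | box =>
      refine .schematic (S := G4 Var) (s := .r) (k := ModalCon.box) rfl args
        (Γ := {⟨.l, .conn _ args⟩})
        (fun F hF => ?_) fun n =>
        .schematic_of_mem (S := G4 Var) (s := .l) (k := ModalCon.box) rfl
          (args := args) (by simp) fun m =>
        (ih m).mono ?_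
      · rw [Multiset.mem_singleton.1 hF]
        exact ⟨args (0 : Fin 1), congrArg (Formula.conn _)
          (funext fun i => congrArg args (Subsingleton.elim (α := Fin 1) _ _))⟩
      · change Fin 1 at m
        change Fin 1 at n
        fin_cases n
        fin_cases m
        · change _ ⊆ (_ + {⟨.r, args (0 : Fin 1)⟩} + {⟨.l, args (0 : Fin 1)⟩} :
            Sequent modalLanguage Var)
          simp [Multiset.subset_iff]

/-! ### The canonical model -/

/-- The saturated sequents with the same boxed formulas as `Γ₀`. -/
def World (Γ₀ : Sequent modalLanguage Var) : Type v :=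
  {Γ : Sequent modalLanguage Var // (G4 Var).Saturated Γ ∧
    ∀ s A, (⟨s, box A⟩ : LFormula modalLanguage Var) ∈ Γ ↔ ⟨s, box A⟩ ∈ Γ₀}

namespace World

variable {Γ₀ : Sequent modalLanguage Var}

instance : Preorder (World Γ₀) where
  le Γ Δ := ∀ A, (⟨.l, A⟩ : LFormula modalLanguage Var) ∈ Γ.1 → ⟨.l, A⟩ ∈ Δ.1
  le_refl _ _ h := h
  le_trans _ _ _ h₁ h₂ A h := h₂ A (h₁ A h)

theorem le_def {w w' : World Γ₀} :
    w ≤ w' ↔ ∀ A, (⟨.l, A⟩ : LFormula modalLanguage Var) ∈ w.1 → ⟨.l, A⟩ ∈ w'.1 :=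
  Iff.rfl

/-- The valuation of the canonical model. -/
def val (x : Var) (w : World Γ₀) : Prop := ⟨.l, .var x⟩ ∈ w.1

/-- Saturating `Θ` yields a world because no new boxed formula can appear. One that did would be a
subformula of `w`, hence decided there; with the opposite label in `w` it would also have that label
in `Θ`, and the extension would contain an identity. -/
theorem exists_extension (w : World Γ₀) {Θ : Sequent modalLanguage Var}
    (hΘ : ¬ (G4 Var).AnalyticProvable Θ)
    (hsub : ∀ F ∈ Θ, ∃ G ∈ w.1, F.formula.Subformula G.formula)
    (hbox : ∀ s A, (⟨s, box A⟩ : LFormula modalLanguage Var) ∈ w.1 → ⟨s, box A⟩ ∈ Θ) :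
    ∃ w' : World Γ₀, Θ ⊆ w'.1 := by
  obtain ⟨Δ, hΔ, hsat, hF⟩ := exists_saturated hΘ
  refine ⟨⟨Δ, hsat, fun s A => ?_⟩, hΔ⟩
  rw [← w.2.2 s A]
  refine ⟨fun h => ?_, fun h => hΔ (hbox s A h)⟩
  obtain ⟨G, hG, hAG⟩ := hF _ h
  obtain ⟨H, hH, hGH⟩ := hsub G hG
  have hd := w.2.1.decided H hH _ (hAG.trans hGH)
  have hid := analyticProvable_identity (Var := Var)
  cases s
  · refine hd.resolve_right fun hr => ?_
    exact hsat.not_mem_right hid h (hΔ (hbox _ _ hr))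
  · refine hd.resolve_left fun hl => ?_
    exact hsat.not_mem_right hid (hΔ (hbox _ _ hl)) h

/-- The context of `(→r)` keeps all left formulas, which gives `w ≤ w'`, and the boxed right ones,
which keeps the new world in the model. -/
theorem exists_of_imp (w : World Γ₀)
    {args : Fin (modalLanguage.arity ModalCon.imp) → Formula modalLanguage Var}
    (h : ⟨.r, .conn (L := modalLanguage) ModalCon.imp args⟩ ∈ w.1) :
    ∃ w', w ≤ w' ∧ ⟨.l, args (0 : Fin 2)⟩ ∈ w'.1 ∧ ⟨.r, args (1 : Fin 2)⟩ ∈ w'.1 := by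
  classical
  obtain ⟨m, hm⟩ := exists_unprovable_premise (S := G4 Var) (s := .r) (k := ModalCon.imp) rfl
    w.2.1.unprovable h
  obtain rfl : m = (0 : Fin 1) := Subsingleton.elim (α := Fin 1) _ _
  refine (w.exists_extension hm ?_ ?_).elim fun w' hw' => ?_
  · intro F hF
    rcases Multiset.mem_add.1 hF with hF | hF
    · exact ⟨F, (Multiset.mem_filter.1 hF).1, .refl _⟩
    · obtain ⟨t, -, rfl⟩ := Multiset.mem_map.1 hF
      exact ⟨_, h, .arg t.2 (.refl _)⟩
  · intro s A hA
    refine Multiset.mem_add.2 (Or.inl (Multiset.mem_filter.2 ⟨hA, ?_⟩))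
    cases s
    · exact Or.inl rfl
    · exact Or.inr ⟨rfl, A, rfl⟩
  · refine ⟨w', fun A hA => hw' ?_, hw' ?_, hw' ?_⟩
    · exact Multiset.mem_add.2 (Or.inl (Multiset.mem_filter.2 ⟨hA, Or.inl rfl⟩))
    · exact Multiset.mem_add.2 (Or.inr (mem_pair_left _ _))
    · exact Multiset.mem_add.2 (Or.inr (mem_pair_right _ _))

theorem exists_of_box (w : World Γ₀)
    {args : Fin (modalLanguage.arity ModalCon.box) → Formula modalLanguage Var}
    (h : ⟨.r, .conn (L := modalLanguage) ModalCon.box args⟩ ∈ w.1) :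
    ∃ w' : World Γ₀, ⟨.r, args (0 : Fin 1)⟩ ∈ w'.1 := by
  classical
  obtain ⟨m, hm⟩ := exists_unprovable_premise (S := G4 Var) (s := .r) (k := ModalCon.box) rfl
    w.2.1.unprovable h
  obtain rfl : m = (0 : Fin 1) := Subsingleton.elim (α := Fin 1) _ _
  refine (w.exists_extension hm ?_ ?_).elim fun w' hw' => ?_
  · intro F hF
    rcases Multiset.mem_add.1 hF with hF | hF
    · exact ⟨F, (Multiset.mem_filter.1 hF).1, .refl _⟩
    · obtain ⟨t, -, rfl⟩ := Multiset.mem_map.1 hF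
      exact ⟨_, h, .arg t.2 (.refl _)⟩
  · intro s A hA
    exact Multiset.mem_add.2 (Or.inl (Multiset.mem_filter.2 ⟨hA, A, rfl⟩))
  · exact ⟨w', hw' (Multiset.mem_add.2 (Or.inr (Multiset.mem_singleton_self _)))⟩

/-- Unrestricted rules are inverted inside a single saturated sequent; right `→` and right `□` need
another world. Left `□` reaches every world because all worlds share their boxed formulas. -/
theorem truth (A : Formula modalLanguage Var) (w : World Γ₀) :
    (⟨.l, A⟩ ∈ w.1 → Forces val A w) ∧ (⟨.r, A⟩ ∈ w.1 → ¬ Forces val A w) := by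
  have hid := analyticProvable_identity (Var := Var)
  induction A generalizing w with
  | var x => exact ⟨_root_.id, fun hr hl => w.2.1.not_mem_right hid hl hr⟩
  | conn c args ih =>
    cases c with
    | bot =>
      refine ⟨fun h => ?_, fun _ => _root_.id⟩
      obtain ⟨m, -⟩ := w.2.1.exists_premise_mem (s := .l) (k := ModalCon.bot) rfl hid h
      exact Fin.elim0 m
    | and =>
      refine ⟨fun h => ?_, fun h hf => ?_⟩
      · obtain ⟨m, hm⟩ := w.2.1.exists_premise_mem (s := .l) (k := ModalCon.and) rfl hid h
        change Fin 1 at m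
        fin_cases m
        exact ⟨(ih _ w).1 (hm (.l, (0 : Fin 2)) (mem_pair_left _ _)),
          (ih _ w).1 (hm (.l, (1 : Fin 2)) (mem_pair_right _ _))⟩
      · obtain ⟨m, hm⟩ := w.2.1.exists_premise_mem (s := .r) (k := ModalCon.and) rfl hid h
        change Fin 2 at m
        fin_cases m
        · exact (ih _ w).2 (hm (.r, (0 : Fin 2)) (Multiset.mem_singleton_self _)) hf.1
        · exact (ih _ w).2 (hm (.r, (1 : Fin 2)) (Multiset.mem_singleton_self _)) hf.2
    | or =>
      refine ⟨fun h => ?_, fun h hf => ?_⟩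
      · obtain ⟨m, hm⟩ := w.2.1.exists_premise_mem (s := .l) (k := ModalCon.or) rfl hid h
        change Fin 2 at m
        fin_cases m
        · exact Or.inl ((ih _ w).1 (hm (.l, (0 : Fin 2)) (Multiset.mem_singleton_self _)))
        · exact Or.inr ((ih _ w).1 (hm (.l, (1 : Fin 2)) (Multiset.mem_singleton_self _)))
      · obtain ⟨m, hm⟩ := w.2.1.exists_premise_mem (s := .r) (k := ModalCon.or) rfl hid h
        change Fin 1 at m
        fin_cases m
        exact hf.elim ((ih _ w).2 (hm (.r, (0 : Fin 2)) (mem_pair_left _ _)))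
          ((ih _ w).2 (hm (.r, (1 : Fin 2)) (mem_pair_right _ _)))
    | imp =>
      refine ⟨fun h w' hw hA => ?_, fun h hf => ?_⟩
      · obtain ⟨m, hm⟩ := w'.2.1.exists_premise_mem (s := .l) (k := ModalCon.imp) rfl hid
          (le_def.1 hw _ h)
        change Fin 2 at m
        fin_cases m
        · exact absurd hA ((ih _ w').2 (hm (.r, (0 : Fin 2)) (Multiset.mem_singleton_self _)))
        · exact (ih _ w').1 (hm (.l, (1 : Fin 2)) (Multiset.mem_singleton_self _))
      · obtain ⟨w', hw, hA, hB⟩ := w.exists_of_imp h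
        exact (ih _ w').2 hB (hf w' hw ((ih _ w').1 hA))
    | box =>
      refine ⟨fun h w' => ?_, fun h hf => ?_⟩
      · have h' : ⟨.l, .conn (L := modalLanguage) ModalCon.box args⟩ ∈ w'.1 := by
          -- Puts the formula in the form `box A`, which is stated with a constant argument
          -- function.
          have hargs : args = fun _ => args (0 : Fin 1) :=
            funext fun i => congrArg args (Subsingleton.elim (α := Fin 1) _ _)
          rw [hargs] at h ⊢
          exact (w'.2.2 _ _).2 ((w.2.2 _ _).1 h)
        obtain ⟨m, hm⟩ := w'.2.1.exists_premise_mem (s := .l) (k := ModalCon.box) rfl hid h'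
        change Fin 1 at m
        fin_cases m
        exact (ih _ w').1 (hm (.l, (0 : Fin 1)) (Multiset.mem_singleton_self _))
      · obtain ⟨w', hw⟩ := w.exists_of_box h
        exact (ih _ w').2 hw (hf w')

end World

theorem analyticCutProperty : (G4 Var).AnalyticCutProperty := by
  rintro Γ ⟨d⟩
  by_contra hΓ
  obtain ⟨Γ₀, hsub, hsat, -⟩ := exists_saturated (S := G4 Var) hΓ
  let w : World Γ₀ := ⟨Γ₀, hsat, fun _ _ => Iff.rfl⟩
  refine soundness (V := World.val (Γ₀ := Γ₀)) (fun x w w' hw h => World.le_def.1 hw _ h) d w ?_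
  rintro ⟨s, A⟩ hF
  cases s
  · exact (World.truth A w).1 (hsub hF)
  · exact (World.truth A w).2 (hsub hF)

/-! ### Context conditions on the connectives -/

theorem rightable_imp : (G4 Var).Rightable ModalCon.imp := by
  intro args s k h
  -- Only `(→r)` and `(5)` remain; neither admits an implication on the right, since it is not
  -- boxed.
  cases s <;> cases k <;> first | rfl | skip
  · rcases h with h | ⟨-, A, h⟩ <;> cases h
  · obtain ⟨A, h⟩ := h
    cases h

theorem weaklyLeftable_imp : (G4 Var).WeaklyLeftable ModalCon.imp := by
  intro args s k h
  cases s <;> cases k <;> first | exact Set.subset_univ _ | exact subset_rfl | skip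
  obtain ⟨A, h⟩ := h
  cases h

theorem ctxFive_subset_ctxImp : ctxFive Var ⊆ ctxImp Var := by
  rintro ⟨s, A⟩ h
  cases s
  · exact Or.inl rfl
  · exact Or.inr ⟨rfl, h⟩

theorem weaklyLeftable_box : (G4 Var).WeaklyLeftable ModalCon.box := by
  intro args s k h
  cases s <;> cases k <;>
    first | exact Set.subset_univ _ | exact subset_rfl | exact ctxFive_subset_ctxImp

theorem inverseRightable_box : (G4 Var).InverseRightable ModalCon.box := by
  intro args s k h
  -- The restriction of `(5)` ignores labels, so it is stable under swapping them.
  have hinv : LFormula.inv '' ctxFive Var ⊆ ctxFive Var := by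
    rintro _ ⟨F, hF, rfl⟩
    exact hF
  cases s <;> cases k <;>
    first | exact Set.subset_univ _ | exact hinv | exact hinv.trans ctxFive_subset_ctxImp

end G4

end CutRestriction

theorem mainTheorem6 (Var : Type*) :
    (CutRestriction.G4 Var).AnalyticCutProperty ∧
    (CutRestriction.G4 Var).Rightable CutRestriction.ModalCon.imp ∧
    (CutRestriction.G4 Var).WeaklyLeftable CutRestriction.ModalCon.imp ∧
    (CutRestriction.G4 Var).WeaklyLeftable CutRestriction.ModalCon.box ∧
    (CutRestriction.G4 Var).InverseRightable CutRestriction.ModalCon.box :=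
  ⟨CutRestriction.G4.analyticCutProperty, CutRestriction.G4.rightable_imp,
    CutRestriction.G4.weaklyLeftable_imp, CutRestriction.G4.weaklyLeftable_box,
    CutRestriction.G4.inverseRightable_box⟩
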